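/- **Stability (equicoercivity) of the finite-element-trained deep Ritz energy.** Let $d\ge 1$ (in particular $d=1,2,3$), let $\Omega\subset\mathbb R^d$ be a bounded polygonal (polyhedral) open set, let $q\ge 1$ and let $f\in C^0(\bar\Omega)$. For each $\ell\in\mathbb N$ let $T_\ell$ be a conforming simplicial triangulation of $\bar\Omega$ for which $\partial\Omega$ is a union of faces, and let $$S_\ell=\{w\in C^0(\bar\Omega): w=0 \text{ on } \partial\Omega,\ w|_K\in\mathbb P_q(K)\ \text{ for all } K\in T_\ell\}$$ be the associated finite element space. Let $\mathcal Z_\ell$ be the set of those degree-$q$ Lagrange points of the elements (the points with barycentric coordinates in $\tfrac1q\mathbb N$) that do not lie on $\partial\Omega$, let $\{\Phi_z\}_{z\in\mathcal Z_\ell}\subset S_\ell$ be the Lagrange basis, $\Phi_z(z')=\delta_{zz'}$, and let $I_\ell u=\sum_{z\in\mathcal Z_\ell}u(z)\Phi_z$ for $u\in C^0(\bar\Omega)$. Put $$\mathcal E_\ell(v)=\int_\Omega\Big(\tfrac12|\nabla I_\ell v|^2-I_\ell(fv)\Big)\,dx ,\qquad v\in C^0(\bar\Omega).$$ Let $\sigma:\mathbb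 R\to\mathbb R$ be continuous and, for each $\ell$, let $V_\ell\subset C^0(\bar\Omega)$ be the set of functions $x\mapsto (C_L\circ\sigma\circ C_{L-1}\circ\cdots\circ\sigma\circ C_1)(x)$ realized by the scalar-valued neural networks of some fixed architecture depending on $\ell$ (number $L$ of affine layers $C_k y=W_ky+b_k$ and layer widths), with activation $\sigma$ acting componentwise. Then for every $C>0$ there is a constant $C_1>0$ such that, for every sequence $(v_\ell)$ with $v_\ell\in V_\ell$ and $$\mathcal E_\ell(v_\ell)\le C\quad\text{for all }\ell,$$ one has $I_\ell v_\ell\in H^1(\Omega)$ and $$\|I_\ell v_\ell\|_{H^1(\Omega)}\le C_1\quad\text{for all }\ell .$$ -/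

import Mathlib

open MeasureTheory Set
open scoped ContDiff

noncomputable section

namespace DeepRitzFE

/-- The ambient space `ℝ^d` with its Euclidean norm and Lebesgue measure. -/
abbrev Sp (d : ℕ) : Type := EuclideanSpace ℝ (Fin d)

/-! ## Sobolev space `H¹` through weak gradients -/

/-- `G` is a weak gradient of `u` on the open set `Ω`: both are locally integrable on `Ω` and
`∫_Ω u ∂ᵢφ = - ∫_Ω Gᵢ φ` for all `φ ∈ C_c^∞(Ω)` and all `i`. -/
def HasWeakGrad {d : ℕ} (Ω : Set (Sp d)) (u : Sp d → ℝ) (G : Sp d → Sp d) : Prop :=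
  LocallyIntegrableOn u Ω ∧ LocallyIntegrableOn G Ω ∧
    ∀ φ : Sp d → ℝ, ContDiff ℝ ∞ φ → HasCompactSupport φ → tsupport φ ⊆ Ω →
      ∀ i : Fin d, ∫ x in Ω, u x * fderiv ℝ φ x (EuclideanSpace.single i 1)
        = - ∫ x in Ω, G x i * φ x

open Classical in
/-- The weak gradient `∇u` on `Ω` (a representative; it is unique almost everywhere in `Ω`), and
`0` if `u` has none. -/
def weakGrad {d : ℕ} (Ω : Set (Sp d)) (u : Sp d → ℝ) : Sp d → Sp d :=
  if h : ∃ G, HasWeakGrad Ω u G then h.choose else 0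

/-- `u ∈ H¹(Ω)`. -/
def MemH1 {d : ℕ} (Ω : Set (Sp d)) (u : Sp d → ℝ) : Prop :=
  MemLp u 2 (volume.restrict Ω) ∧
    ∃ G, HasWeakGrad Ω u G ∧ MemLp G 2 (volume.restrict Ω)

/-- The norm of `H¹(Ω)`: `(‖u‖²_{L²(Ω)} + ‖∇u‖²_{L²(Ω)})^{1/2}`. -/
def h1Norm {d : ℕ} (Ω : Set (Sp d)) (u : Sp d → ℝ) : ℝ :=
  √((∫ x in Ω, (u x) ^ 2) + ∫ x in Ω, ‖weakGrad Ω u x‖ ^ 2)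

/-! ## Neural networks -/

/-- The parameters `θ` (weights and biases) of a network with input dimension `m`, hidden layers
of the widths given by the list, and scalar output. With hidden widths `[n₁, …, n_{L-1}]` the
network has `L` affine layers. -/
inductive Network : ℕ → List ℕ → Type where
  | output {m : ℕ} (W : Matrix (Fin 1) (Fin m) ℝ) (b : Fin 1 → ℝ) : Network m []
  | hidden {m n : ℕ} {ns : List ℕ} (W : Matrix (Fin n) (Fin m) ℝ) (b : Fin n → ℝ)
      (rest : Network n ns) : Network m (n :: ns)

/-- The map `C_L ∘ σ ∘ C_{L-1} ∘ ⋯ ∘ σ ∘ C₁` with `C_k y = W_k y + b_k` and the activation `σ`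
acting componentwise. -/
def Network.realize (σ : ℝ → ℝ) : {m : ℕ} → {ns : List ℕ} → Network m ns → (Fin m → ℝ) → ℝ
  | _, _, .output W b, y => (W.mulVec y + b) 0
  | _, _, .hidden W b rest, y => rest.realize σ fun i => σ ((W.mulVec y + b) i)

/-- The set `V_𝒩 ⊆ C⁰(Ω̄)` of the functions on `Ω̄` realized by networks of the architecture with
hidden widths `ns` and activation `σ`. -/
def networkSpace {d : ℕ} (Ω : Set (Sp d)) (σ : ℝ → ℝ) (ns : List ℕ) : Set C(closure Ω, ℝ) :=
  {v | ∃ θ : Network d ns, ∀ x : closure Ω, v x = θ.realize σ fun i => (x : Sp d) i}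

/-! ## Triangulations and Lagrange finite elements -/

/-- A (conforming) triangulation of the polygonal (polyhedral) open set `Ω ⊆ ℝ^d`: a finite
geometric simplicial complex, all of whose faces are faces of `d`-simplices, which covers exactly
`Ω̄`, and which resolves the boundary: `∂Ω` is a union of faces. -/
structure Triangulation {d : ℕ} (Ω : Set (Sp d)) extends
    Geometry.SimplicialComplex ℝ (Sp d) where
  finite_faces : faces.Finite
  pure : ∀ s ∈ faces, ∃ t ∈ faces, s ⊆ t ∧ t.card = d + 1
  space_eq : toSimplicialComplex.space = closure Ω
  frontier_faces : ∀ x ∈ frontier Ω, ∃ s ∈ faces,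
    x ∈ convexHull ℝ (s : Set (Sp d)) ∧ convexHull ℝ (s : Set (Sp d)) ⊆ frontier Ω

namespace Triangulation

variable {d : ℕ} {Ω : Set (Sp d)}

open Classical in
/-- The elements `K ∈ T_h`, each given by the `d + 1` vertices of the simplex. -/
def elements (T : Triangulation Ω) : Finset (Finset (Sp d)) :=
  T.finite_faces.toFinset.filter fun s => s.card = d + 1

open Classical in
/-- The vertices of the triangulation. -/
def verts (T : Triangulation Ω) : Finset (Sp d) := T.elements.biUnion id

/-- The finite element space `S_h(Ω)` of continuous functions on `Ω̄` which vanish on `∂Ω` and are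
polynomials of degree at most `q` on every element. Functions in `C⁰₀(Ω̄)` are identified with
their (continuous) extension by zero to `ℝ^d`. -/
def femSpace (T : Triangulation Ω) (q : ℕ) : Submodule ℝ (Sp d → ℝ) where
  carrier := {v | Continuous v ∧ (∀ x, x ∉ Ω → v x = 0) ∧
    ∀ s ∈ T.elements, ∃ p : MvPolynomial (Fin d) ℝ, p.totalDegree ≤ q ∧
      ∀ x ∈ convexHull ℝ (s : Set (Sp d)), v x = MvPolynomial.eval (fun i => x i) p}
  zero_mem' := ⟨continuous_zero, fun _ _ => rfl, fun _ _ => ⟨0, by simp, by simp⟩⟩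
  add_mem' := by
    rintro u v ⟨hu, hu0, hup⟩ ⟨hv, hv0, hvp⟩
    refine ⟨hu.add hv, fun x hx => by simp [hu0 x hx, hv0 x hx], fun s hs => ?_⟩
    obtain ⟨p, hp, hpe⟩ := hup s hs
    obtain ⟨r, hr, hre⟩ := hvp s hs
    exact ⟨p + r, (MvPolynomial.totalDegree_add p r).trans (max_le hp hr),
      fun x hx => by simp [hpe x hx, hre x hx]⟩
  smul_mem' := by
    rintro c u ⟨hu, hu0, hup⟩
    refine ⟨hu.const_smul c, fun x hx => by simp [hu0 x hx], fun s hs => ?_⟩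
    obtain ⟨p, hp, hpe⟩ := hup s hs
    exact ⟨c • p, (MvPolynomial.totalDegree_smul_le c p).trans hp,
      fun x hx => by simp [hpe x hx, MvPolynomial.smul_eval]⟩

open Classical in
/-- The Lagrange points of degree `q` (principal lattice) of the simplex with vertex set `s`: the
points with barycentric coordinates `α / q`, `α ∈ ℕ^s`, `|α| = q`. -/
def lattice (q : ℕ) (s : Finset (Sp d)) : Finset (Sp d) :=
  (s.piAntidiag q).image fun α => ∑ a ∈ s, ((α a : ℝ) / q) • a

open Classical in
/-- The set `𝒵` of degrees of freedom of `S_h(Ω)`: the Lagrange points of all elements, apart from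
those on `∂Ω`. -/
def nodes (T : Triangulation Ω) (q : ℕ) : Finset (Sp d) :=
  (T.elements.biUnion fun s => lattice q s).filter fun z => z ∈ Ω

/-- `w` is the family of barycentric coordinates of `x` with respect to some face of the
triangulation, extended by zero to the remaining vertices. -/
def IsBary (T : Triangulation Ω) (x : Sp d) (w : Sp d → ℝ) : Prop :=
  ∃ s ∈ T.faces, (∀ a, 0 ≤ w a) ∧ (∀ a, a ∉ s → w a = 0) ∧
    ∑ a ∈ s, w a = 1 ∧ ∑ a ∈ s, w a • a = x

open Classical in
/-- `T.bary x a` is the barycentric coordinate of `x ∈ Ω̄` at the vertex `a` (as a function of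
`x`, the piecewise linear hat function of `a`). It is `0` for `x ∉ Ω̄`. -/
def bary (T : Triangulation Ω) (x : Sp d) : Sp d → ℝ :=
  if h : ∃ w, T.IsBary x w then h.choose else 0

/-- The Lagrange basis function `Φ_z` of `S_h(Ω)` at the node `z` with barycentric coordinates
`α / q`, written explicitly as `∏_a ∏_{j < α_a} (q λ_a(x) - j) / (j + 1)`. See `lagrange_mem`
and `lagrange_apply` for its defining properties. -/
def lagrange (T : Triangulation Ω) (q : ℕ) (z x : Sp d) : ℝ :=
  ∏ a ∈ T.verts, ∏ j ∈ Finset.range ⌊q * T.bary z a⌋₊, (q * T.bary x a - j) / (j + 1)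

theorem mem_elements {T : Triangulation Ω} {s : Finset (Sp d)} :
    s ∈ T.elements ↔ s ∈ T.faces ∧ s.card = d + 1 := by
  simp [elements]

theorem subset_closure_of_mem (T : Triangulation Ω) {s : Finset (Sp d)} (hs : s ∈ T.faces) :
    convexHull ℝ (s : Set (Sp d)) ⊆ closure Ω :=
  T.space_eq ▸ T.convexHull_subset_space hs

open Classical in
theorem mem_closure_of_mem_nodes (T : Triangulation Ω) {q : ℕ} {z : Sp d}
    (hz : z ∈ T.nodes q) : z ∈ closure Ω :=
  subset_closure (Finset.mem_filter.1 hz).2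

theorem exists_element (T : Triangulation Ω) {x : Sp d} (hx : x ∈ closure Ω) :
    ∃ s ∈ T.elements, x ∈ convexHull ℝ (s : Set (Sp d)) := by
  rw [← T.space_eq, Geometry.SimplicialComplex.mem_space_iff] at hx
  obtain ⟨s, hs, hxs⟩ := hx
  obtain ⟨t, ht, hst, hc⟩ := T.pure s hs
  exact ⟨t, mem_elements.2 ⟨ht, hc⟩, convexHull_mono (by exact_mod_cast hst) hxs⟩

theorem eq_of_indep (T : Triangulation Ω) {s : Finset (Sp d)} (hs : s ∈ T.faces)
    {w w' : Sp d → ℝ} (h1 : ∑ a ∈ s, w a = ∑ a ∈ s, w' a)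
    (h2 : ∑ a ∈ s, w a • a = ∑ a ∈ s, w' a • a) : ∀ a ∈ s, w a = w' a := by
  intro a ha
  have h := affineIndependent_iff.1 (T.indep hs) Finset.univ (fun a => w a - w' a)
    (by
      rw [Finset.sum_coe_sort s (fun a => w a - w' a)]
      simp [h1])
    (by
      rw [Finset.sum_coe_sort s (fun a => (w a - w' a) • a)]
      simp [sub_smul, h2]) ⟨a, ha⟩ (Finset.mem_univ _)
  simpa [sub_eq_zero] using h

open Classical in
theorem IsBary.unique {T : Triangulation Ω} {x : Sp d} {w w' : Sp d → ℝ}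
    (h : T.IsBary x w) (h' : T.IsBary x w') : w = w' := by
  obtain ⟨s, hs, w0, ws, w1, wx⟩ := h
  obtain ⟨t, ht, w0', wt, w1', wx'⟩ := h'
  have hxs : x ∈ convexHull ℝ (s : Set (Sp d)) :=
    Finset.mem_convexHull'.2 ⟨w, fun a _ => w0 a, w1, wx⟩
  have hxt : x ∈ convexHull ℝ (t : Set (Sp d)) :=
    Finset.mem_convexHull'.2 ⟨w', fun a _ => w0' a, w1', wx'⟩
  have hx := T.inter_subset_convexHull hs ht ⟨hxs, hxt⟩
  rw [← Finset.coe_inter, Finset.mem_convexHull'] at hx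
  obtain ⟨v, -, v1, vx⟩ := hx
  have key : ∀ (r : Finset (Sp d)) (_ : r ∈ T.faces) (_ : s ∩ t ⊆ r) (u : Sp d → ℝ)
      (_ : ∀ a, a ∉ r → u a = 0) (_ : ∑ a ∈ r, u a = 1) (_ : ∑ a ∈ r, u a • a = x),
      u = fun a => if a ∈ s ∩ t then v a else 0 := by
    intro r hr hsub u hu0 hu1 hux
    funext a
    by_cases ha : a ∈ r
    · refine T.eq_of_indep hr (w' := fun a => if a ∈ s ∩ t then v a else 0) ?_ ?_ a ha
      · rw [Finset.sum_ite_mem, Finset.inter_eq_right.2 hsub, v1, hu1]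
      · simp only [ite_smul, zero_smul]
        rw [Finset.sum_ite_mem, Finset.inter_eq_right.2 hsub, vx, hux]
    · rw [hu0 a ha, if_neg fun h => ha (hsub h)]
  rw [key s hs Finset.inter_subset_left w ws w1 wx,
    key t ht Finset.inter_subset_right w' wt w1' wx']

theorem IsBary.bary_eq {T : Triangulation Ω} {x : Sp d} {w : Sp d → ℝ} (h : T.IsBary x w) :
    T.bary x = w := by
  have hex : ∃ w, T.IsBary x w := ⟨w, h⟩
  rw [bary, dif_pos hex]
  exact hex.choose_spec.unique h

open Classical in
theorem bary_spec (T : Triangulation Ω) {x : Sp d} {s : Finset (Sp d)} (hs : s ∈ T.faces)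
    (hx : x ∈ convexHull ℝ (s : Set (Sp d))) :
    (∀ a, 0 ≤ T.bary x a) ∧ (∀ a, a ∉ s → T.bary x a = 0) ∧
      ∑ a ∈ s, T.bary x a = 1 ∧ ∑ a ∈ s, T.bary x a • a = x := by
  obtain ⟨w, w0, w1, wx⟩ := Finset.mem_convexHull'.1 hx
  have hb : T.bary x = fun a => if a ∈ s then w a else 0 := by
    apply IsBary.bary_eq
    refine ⟨s, hs, fun a => ?_, fun a ha => by simp [ha], ?_, ?_⟩
    · dsimp only
      split_ifs with h
      exacts [w0 a h, le_rfl]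
    · rw [Finset.sum_ite_mem, Finset.inter_self, w1]
    · simp only [ite_smul, zero_smul]
      rw [Finset.sum_ite_mem, Finset.inter_self, wx]
  rw [hb]
  refine ⟨fun a => ?_, fun a ha => by simp [ha], ?_, ?_⟩
  · dsimp only
    split_ifs with h
    exacts [w0 a h, le_rfl]
  · rw [Finset.sum_ite_mem, Finset.inter_self, w1]
  · simp only [ite_smul, zero_smul]
    rw [Finset.sum_ite_mem, Finset.inter_self, wx]

theorem bary_of_notMem (T : Triangulation Ω) {x : Sp d} (hx : x ∉ closure Ω) : T.bary x = 0 := by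
  rw [bary, dif_neg]
  rintro ⟨w, s, hs, w0, -, w1, wx⟩
  exact hx (T.subset_closure_of_mem hs (Finset.mem_convexHull'.2 ⟨w, fun a _ => w0 a, w1, wx⟩))

/-- On an element the barycentric coordinates are affine functions. -/
theorem exists_affine (T : Triangulation Ω) {s : Finset (Sp d)} (hs : s ∈ T.elements)
    (a : Sp d) : ∃ p : MvPolynomial (Fin d) ℝ, p.totalDegree ≤ (if a ∈ T.verts then 1 else 0) ∧
      ∀ x ∈ convexHull ℝ (s : Set (Sp d)), T.bary x a = MvPolynomial.eval (fun i => x i) p := by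
  obtain ⟨hf, hc⟩ := mem_elements.1 hs
  by_cases ha : a ∈ s
  · have hav : a ∈ T.verts := Finset.mem_biUnion.2 ⟨s, hs, ha⟩
    have htop : affineSpan ℝ (Set.range ((↑) : s → Sp d)) = ⊤ := by
      rw [(T.indep hf).affineSpan_eq_top_iff_card_eq_finrank_add_one]
      simp [hc]
    let b : AffineBasis s ℝ (Sp d) := ⟨(↑), T.indep hf, htop⟩
    let ℓ := b.coord ⟨a, ha⟩
    refine ⟨MvPolynomial.C (ℓ 0) + ∑ i, MvPolynomial.C (ℓ.linear (EuclideanSpace.single i 1)) *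
      MvPolynomial.X i, ?_, fun x hx => ?_⟩
    · rw [if_pos hav]
      refine (MvPolynomial.totalDegree_add _ _).trans (max_le (by simp) ?_)
      refine MvPolynomial.totalDegree_finsetSum_le fun i _ => ?_
      refine (MvPolynomial.totalDegree_mul _ _).trans ?_
      simp
    · obtain ⟨-, -, h1, h2⟩ := T.bary_spec hf hx
      have e1 : ℓ x = T.bary x a := by
        have : Finset.univ.affineCombination ℝ b (fun c : s => T.bary x c) = x := by
          rw [Finset.affineCombination_eq_linear_combination _ _ _
            (by rw [Finset.sum_coe_sort s (fun c => T.bary x c), h1])]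
          exact (Finset.sum_coe_sort s (fun c => T.bary x c • c)).trans h2
        conv_lhs => rw [← this]
        exact b.coord_apply_combination_of_mem (Finset.mem_univ _)
          (by rw [Finset.sum_coe_sort s (fun c => T.bary x c), h1])
      have e2 : ℓ x = ℓ.linear x + ℓ 0 := by
        have := ℓ.map_vadd 0 x
        simpa using this
      have e3 : ℓ.linear x = ∑ i, x i * ℓ.linear (EuclideanSpace.single i 1) := by
        have hx' : x = ∑ i, x i • EuclideanSpace.single i (1 : ℝ) := by
          simpa using ((EuclideanSpace.basisFun (Fin d) ℝ).sum_repr x).symm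
        conv_lhs => rw [hx']
        simp only [map_sum, map_smul, smul_eq_mul]
      rw [← e1, e2, e3]
      simp only [map_add, map_sum, map_mul, MvPolynomial.eval_C, MvPolynomial.eval_X]
      rw [add_comm]
      congr 1
      exact Finset.sum_congr rfl fun i _ => mul_comm _ _
  · exact ⟨0, by simp, fun x hx => by simp [(T.bary_spec hf hx).2.1 a ha]⟩

/-- The coordinates of a node are `α / q` with `α ∈ ℕ^s`, `|α| = q`. -/
theorem bary_node (T : Triangulation Ω) {q : ℕ} (hq : 1 ≤ q) {z : Sp d} (hz : z ∈ T.nodes q) :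
    ∃ s ∈ T.elements, ∃ α : Sp d → ℕ, ∑ a ∈ s, α a = q ∧ (∀ a, a ∉ s → α a = 0) ∧
      (∀ a, q * T.bary z a = α a) ∧ z ∈ convexHull ℝ (s : Set (Sp d)) := by
  classical
  obtain ⟨hz, -⟩ := Finset.mem_filter.1 hz
  obtain ⟨s, hs, hz⟩ := Finset.mem_biUnion.1 hz
  obtain ⟨α, hα, rfl⟩ := Finset.mem_image.1 hz
  obtain ⟨hsum, hsupp⟩ := Finset.mem_piAntidiag.1 hα
  have hq0 : (q : ℝ) ≠ 0 := by positivity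
  have hout : ∀ a, a ∉ s → α a = 0 := fun a ha => by
    by_contra h
    exact ha (hsupp a h)
  have h1 : ∑ a ∈ s, (α a : ℝ) / q = 1 := by
    rw [← Finset.sum_div, ← Nat.cast_sum, hsum, div_self hq0]
  have hb : T.bary (∑ a ∈ s, ((α a : ℝ) / q) • a) = fun a => (α a : ℝ) / q :=
    IsBary.bary_eq ⟨s, (mem_elements.1 hs).1, fun a => by positivity,
      fun a ha => by simp [hout a ha], h1, rfl⟩
  refine ⟨s, hs, α, hsum, hout, fun a => ?_, ?_⟩
  · rw [hb]
    field_simp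
  · exact Finset.mem_convexHull'.2 ⟨_, fun a _ => by positivity, h1, rfl⟩

/-- `Φ_z(x) = 0` as soon as `q λ_a(x)` is a natural number below `q λ_a(z)` for some `a`. -/
theorem lagrange_eq_zero (T : Triangulation Ω) {q : ℕ} {z x a : Sp d} (ha : a ∈ T.verts) {n m : ℕ}
    (hz : q * T.bary z a = n) (hx : q * T.bary x a = m) (h : m < n) : T.lagrange q z x = 0 := by
  refine Finset.prod_eq_zero ha (Finset.prod_eq_zero (i := m) ?_ ?_)
  · rw [hz, Nat.floor_natCast]
    exact Finset.mem_range.2 h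
  · simp [hx]

/-- `Φ_z` belongs to `S_h(Ω)`. -/
theorem lagrange_mem (hΩ : IsOpen Ω) (T : Triangulation Ω) {q : ℕ} (hq : 1 ≤ q) {z : Sp d}
    (hz : z ∈ T.nodes q) : T.lagrange q z ∈ T.femSpace q := by
  classical
  have hzΩ : z ∈ Ω := (Finset.mem_filter.1 hz).2
  obtain ⟨s, hs, α, hsum, hout, hα, hzs⟩ := T.bary_node hq hz
  have hsv : s ⊆ T.verts := Finset.subset_biUnion_of_mem id hs
  have hout0 : ∀ x, x ∉ Ω → T.lagrange q z x = 0 := by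
    intro x hx
    by_cases hxc : x ∈ closure Ω
    · have hxf : x ∈ frontier Ω := by
        rw [hΩ.frontier_eq]
        exact ⟨hxc, hx⟩
      obtain ⟨t, ht, hxt, htf⟩ := T.frontier_faces x hxf
      obtain ⟨a, has, hat, ha0⟩ : ∃ a ∈ s, a ∉ t ∧ α a ≠ 0 := by
        by_contra! hcon
        have hq0 : (0 : ℝ) < q := by positivity
        have hb : ∀ a, T.bary z a = (α a : ℝ) / q := fun a => by
          rw [← hα a]
          field_simp
        obtain ⟨-, -, h1, h2⟩ := T.bary_spec (mem_elements.1 hs).1 hzs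
        have hzt : z ∈ convexHull ℝ (t : Set (Sp d)) := by
          have hz2 : ∀ a ∈ s, a ∉ t → T.bary z a = 0 := fun a ha hat => by
            simp [hb, hcon a ha hat]
          have hz3 : ∀ a ∈ t, a ∉ s → T.bary z a = 0 := fun a _ has => by
            simp [hb, hout a has]
          have g1 : ∑ a ∈ t, T.bary z a = ∑ a ∈ s, T.bary z a :=
            Finset.sum_congr_of_eq_on_inter hz3 hz2 fun _ _ _ => rfl
          have g2 : ∑ a ∈ t, T.bary z a • a = ∑ a ∈ s, T.bary z a • a :=
            Finset.sum_congr_of_eq_on_inter (fun a h h' => by simp [hz3 a h h'])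
              (fun a h h' => by simp [hz2 a h h']) fun _ _ _ => rfl
          refine Finset.mem_convexHull'.2 ⟨T.bary z, fun a _ => ?_, g1.trans h1, g2.trans h2⟩
          rw [hb]
          positivity
        have := htf hzt
        rw [hΩ.frontier_eq] at this
        exact this.2 hzΩ
      exact T.lagrange_eq_zero (hsv has) (hα a) (m := 0)
        (by simp [(T.bary_spec ht hxt).2.1 a hat]) (Nat.pos_of_ne_zero ha0)
    · obtain ⟨a, ha, ha0⟩ : ∃ a ∈ s, α a ≠ 0 := by
        by_contra! hcon
        rw [Finset.sum_eq_zero hcon] at hsum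
        omega
      exact T.lagrange_eq_zero (hsv ha) (hα a) (m := 0)
        (by simp [T.bary_of_notMem hxc]) (Nat.pos_of_ne_zero ha0)
  have hpoly : ∀ t ∈ T.elements, ∃ p : MvPolynomial (Fin d) ℝ, p.totalDegree ≤ q ∧
      ∀ x ∈ convexHull ℝ (t : Set (Sp d)),
        T.lagrange q z x = MvPolynomial.eval (fun i => x i) p := by
    intro t ht
    choose p hp hpe using T.exists_affine ht
    refine ⟨∏ a ∈ T.verts, ∏ j ∈ Finset.range ⌊q * T.bary z a⌋₊,
      (MvPolynomial.C ((1 : ℝ) / (j + 1)) * (MvPolynomial.C (q : ℝ) * p a -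
        MvPolynomial.C (j : ℝ))), ?_, fun x hx => ?_⟩
    · calc _ ≤ ∑ a ∈ T.verts, ∑ j ∈ Finset.range ⌊q * T.bary z a⌋₊, 1 := by
            refine (MvPolynomial.totalDegree_finsetProd _ _).trans
              (Finset.sum_le_sum fun a ha => ?_)
            refine (MvPolynomial.totalDegree_finsetProd _ _).trans
              (Finset.sum_le_sum fun j _ => ?_)
            have h1 := hp a
            rw [if_pos ha] at h1
            refine (MvPolynomial.totalDegree_mul _ _).trans ?_
            rw [MvPolynomial.totalDegree_C, zero_add]
            refine (MvPolynomial.totalDegree_sub _ _).trans (max_le ?_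
              ((MvPolynomial.totalDegree_C _).le.trans (Nat.zero_le _)))
            refine (MvPolynomial.totalDegree_mul _ _).trans ?_
            rw [MvPolynomial.totalDegree_C, zero_add]
            exact h1
        _ = ∑ a ∈ T.verts, α a := by simp [hα]
        _ = ∑ a ∈ s, α a := (Finset.sum_subset hsv fun a _ ha => hout a ha).symm
        _ ≤ q := hsum.le
    · simp only [lagrange, map_prod, map_mul, map_sub, MvPolynomial.eval_C]
      refine Finset.prod_congr rfl fun a _ => Finset.prod_congr rfl fun j _ => ?_
      rw [← hpe a x hx]
      ring
  refine ⟨?_, hout0, hpoly⟩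
  have hcl : ContinuousOn (T.lagrange q z) (closure Ω) := by
    have hU : closure Ω = ⋃ t : T.elements, convexHull ℝ ((t : Finset (Sp d)) : Set (Sp d)) := by
      ext x
      simp only [mem_iUnion]
      constructor
      · intro hx
        obtain ⟨t, ht, hxt⟩ := T.exists_element hx
        exact ⟨⟨t, ht⟩, hxt⟩
      · rintro ⟨t, hxt⟩
        exact T.subset_closure_of_mem (mem_elements.1 t.2).1 hxt
    rw [hU]
    refine (locallyFinite_of_finite _).continuousOn_iUnion
      (fun t => (t : Finset (Sp d)).finite_toSet.isClosed_convexHull ℝ) fun t => ?_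
    obtain ⟨p, -, hpe⟩ := hpoly t t.2
    refine ContinuousOn.congr ?_ hpe
    exact ((MvPolynomial.continuous_eval p).comp
      (by fun_prop : Continuous fun x : Sp d => fun i => x i)).continuousOn
  have hcompl : ContinuousOn (T.lagrange q z) Ωᶜ :=
    continuousOn_const.congr fun x hx => hout0 x hx
  rw [← continuousOn_univ]
  have : (Set.univ : Set (Sp d)) = closure Ω ∪ Ωᶜ := by
    refine (Set.eq_univ_of_forall fun x => ?_).symm
    by_cases hx : x ∈ Ω
    exacts [Or.inl (subset_closure hx), Or.inr hx]
  rw [this]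
  exact hcl.union_of_isClosed hcompl isClosed_closure hΩ.isClosed_compl

open Classical in
/-- `Φ_z(z') = δ_{z z'}` for all degrees of freedom `z, z'`. -/
theorem lagrange_apply (T : Triangulation Ω) {q : ℕ} (hq : 1 ≤ q) {z z' : Sp d}
    (hz : z ∈ T.nodes q) (hz' : z' ∈ T.nodes q) :
    T.lagrange q z z' = if z' = z then 1 else 0 := by
  obtain ⟨s, hs, α, hsum, hout, hα, hzs⟩ := T.bary_node hq hz
  obtain ⟨t, ht, β, hsum', hout', hβ, hzt⟩ := T.bary_node hq hz'
  have hsv : s ⊆ T.verts := Finset.subset_biUnion_of_mem id hs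
  have htv : t ⊆ T.verts := Finset.subset_biUnion_of_mem id ht
  have hq0 : (q : ℝ) ≠ 0 := by positivity
  split_ifs with h
  · subst h
    refine Finset.prod_eq_one fun a _ => ?_
    rw [hα, Nat.floor_natCast, Finset.prod_div_distrib,
      Finset.prod_range_natCast_sub, ← Nat.descFactorial_eq_prod_range,
      Nat.descFactorial_self]
    have : ∏ j ∈ Finset.range (α a), ((j : ℝ) + 1) = ((α a).factorial : ℝ) := by
      rw [← Finset.prod_range_add_one_eq_factorial]
      push_cast
      rfl
    rw [this, div_self (by positivity)]
  · obtain ⟨a, ha, hlt⟩ : ∃ a ∈ T.verts, β a < α a := by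
      by_contra! hcon
      have h1 : ∑ a ∈ T.verts, α a = ∑ a ∈ T.verts, β a := by
        rw [← Finset.sum_subset hsv fun a _ ha => hout a ha,
          ← Finset.sum_subset htv fun a _ ha => hout' a ha, hsum, hsum']
      have h2 : ∀ a ∈ T.verts, α a = β a := (Finset.sum_eq_sum_iff_of_le hcon).1 h1
      apply h
      obtain ⟨-, hs0, -, e1⟩ := T.bary_spec (mem_elements.1 hs).1 hzs
      obtain ⟨-, ht0, -, e2⟩ := T.bary_spec (mem_elements.1 ht).1 hzt
      rw [← e1, ← e2, Finset.sum_subset hsv fun a _ ha => by simp [hs0 a ha],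
        Finset.sum_subset htv fun a _ ha => by simp [ht0 a ha]]
      refine Finset.sum_congr rfl fun a ha => ?_
      have : (q : ℝ) * T.bary z' a = q * T.bary z a := by rw [hα, hβ, h2 a ha]
      rw [mul_left_cancel₀ hq0 this]
    exact T.lagrange_eq_zero ha (hα a) (hβ a) hlt

/-- The interpolant `I_{S_h} u = ∑_{z ∈ 𝒵} u(z) Φ_z`. -/
def interp (T : Triangulation Ω) (q : ℕ) (u : C(closure Ω, ℝ)) : Sp d → ℝ :=
  fun x => ∑ z ∈ (T.nodes q).attach,
    u ⟨z, T.mem_closure_of_mem_nodes z.2⟩ * T.lagrange q z x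

/-- `I_{S_h}` maps `C⁰(Ω̄)` to `S_h(Ω)`. -/
theorem interp_mem (hΩ : IsOpen Ω) (T : Triangulation Ω) {q : ℕ} (hq : 1 ≤ q)
    (u : C(closure Ω, ℝ)) : T.interp q u ∈ T.femSpace q := by
  have : T.interp q u = ∑ z ∈ (T.nodes q).attach,
      u ⟨z, T.mem_closure_of_mem_nodes z.2⟩ • T.lagrange q z := by
    funext x
    simp [interp, Finset.sum_apply]
  rw [this]
  exact Submodule.sum_mem _ fun z _ => Submodule.smul_mem _ _ (T.lagrange_mem hΩ hq z.2)

/-- The discrete energy `∫_Ω (½ |∇ I_{S_h} v|² - I_{S_h}(f v)) dx`. -/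
def energy (T : Triangulation Ω) (q : ℕ) (f v : C(closure Ω, ℝ)) : ℝ :=
  ∫ x in Ω, ((1 / 2) * ‖weakGrad Ω (T.interp q v) x‖ ^ 2 - T.interp q (f * v) x)

end Triangulation

end DeepRitzFE

end

/-! Write w for the interpolant of v. The energy is ½‖∇w‖² minus the load ∫ I(fv), so the claim
follows once the load grows at most linearly in w, uniformly in the mesh. The energy sees v only at
the nodes and says nothing about its size elsewhere, so the load has to be estimated through w and
not through v.

On one element the nodal values of fv are those of v multiplied by numbers of size at most ‖f‖. On
the finite-dimensional space of polynomials of degree at most q the L¹ norm is equivalent to the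
maximum of the Lagrange coefficients, so this multiplication is bounded in L¹. An affine change of
variables to a reference simplex multiplies both L¹ norms by the same Jacobian; hence the constant B
depends on d and q only, and neither mesh size nor shape regularity enters
(`exists_integral_shape_le_uniform`). Summing over the elements gives ∫|I(fv)| ≤ B‖f‖ ∫|w|
(`exists_integral_abs_interp_mul_le`). Young's and Poincaré's inequalities absorb the right-hand
side into the gradient term (`integral_norm_partialGrad_sq_le`).

Finite element functions, extended by zero, are Lipschitz on the whole space. Their partial
derivatives therefore form a weak gradient, and all integrations by parts take place on ℝ^d without
any regularity of ∂Ω. -/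

noncomputable section

open Filter Topology NNReal

/-! ### Lipschitz continuity of finite element functions -/

/-- A continuous function which is `L`-Lipschitz on each member of a finite closed cover of a
normed space is `L`-Lipschitz. -/
theorem LipschitzWith.of_finite_closed_cover {E ι : Type*} [NormedAddCommGroup E] [NormedSpace ℝ E]
    [Finite ι] {F : ι → Set E} (hF : ∀ i, IsClosed (F i)) (hcov : ∀ x, ∃ i, x ∈ F i)
    {f : E → ℝ} (hf : Continuous f) {L : ℝ≥0} (hL : ∀ i, LipschitzOnWith L f (F i)) :
    LipschitzWith L f := by
  refine LipschitzWith.of_dist_le_mul fun y x => ?_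
  set γ : ℝ → E := fun t => AffineMap.lineMap x y t with hγ
  have hγc : Continuous γ := AffineMap.lineMap_continuous
  have hγd : ∀ s t, dist (γ s) (γ t) = dist s t * dist x y := fun s t =>
    dist_lineMap_lineMap x y s t
  set K : ℝ := L * dist x y
  -- Along the segment γ it suffices that, for every r > K, the right difference quotient at t is
  -- below r for some z arbitrarily close to t; no derivative of f is needed.
  have key := image_le_of_liminf_slope_right_le_deriv_boundary (a := 0) (b := 1)
    (f := fun t => |f (γ t) - f x|) (by fun_prop) (B := fun t => K * t) (B' := fun _ => K)
    (by simp [hγ]) (by fun_prop)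
    (fun t _ => by simpa using ((hasDerivAt_id t).const_mul K).hasDerivWithinAt)
    (fun t _ r hr => ?_) (right_mem_Icc.2 zero_le_one)
  · simpa [hγ, K, Real.dist_eq, dist_comm] using key
  · have hex : ∃ i, ∃ᶠ z in 𝓝[>] t, γ z ∈ F i := by
      by_contra! hcon
      obtain ⟨z, hz⟩ := (eventually_all.2 hcon).exists
      obtain ⟨i, hi⟩ := hcov (γ z)
      exact hz i hi
    obtain ⟨i, hi⟩ := hex
    have hti : γ t ∈ F i := by
      have : t ∈ closure {z | γ z ∈ F i} :=
        mem_closure_iff_frequently.2 (hi.filter_mono nhdsWithin_le_nhds)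
      rwa [show {z | γ z ∈ F i} = γ ⁻¹' F i from rfl, ((hF i).preimage hγc).closure_eq] at this
    refine (hi.and_eventually self_mem_nhdsWithin).mono fun z hz => lt_of_le_of_lt ?_ hr
    have hzt : 0 < z - t := sub_pos.2 hz.2
    rw [slope_def_field, div_le_iff₀ hzt]
    calc |f (γ z) - f x| - |f (γ t) - f x| ≤ |f (γ z) - f (γ t)| := by
          refine (abs_sub_abs_le_abs_sub _ _).trans (le_of_eq ?_)
          congr 1
          ring
      _ ≤ L * dist (γ z) (γ t) := by
          rw [← Real.dist_eq]
          exact (hL i).dist_le_mul _ hz.1 _ hti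
      _ = K * (z - t) := by
          rw [hγd, Real.dist_eq, abs_of_pos hzt]
          ring

namespace DeepRitzFE

namespace Triangulation

variable {d : ℕ} {Ω : Set (Sp d)}

theorem closure_eq_iUnion_elements (T : Triangulation Ω) :
    closure Ω = ⋃ t : T.elements, convexHull ℝ ((t : Finset (Sp d)) : Set (Sp d)) := by
  ext x
  simp only [mem_iUnion]
  constructor
  · intro hx
    obtain ⟨t, ht, hxt⟩ := T.exists_element hx
    exact ⟨⟨t, ht⟩, hxt⟩
  · rintro ⟨t, hxt⟩
    exact T.subset_closure_of_mem (mem_elements.1 t.2).1 hxt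

theorem isCompact_closure (T : Triangulation Ω) : IsCompact (closure Ω) := by
  rw [T.closure_eq_iUnion_elements]
  exact isCompact_iUnion fun t => (t : Finset (Sp d)).finite_toSet.isCompact_convexHull ℝ

/-- Finite element functions are Lipschitz continuous. -/
theorem exists_lipschitzWith_of_mem_femSpace (hΩ : IsOpen Ω) (T : Triangulation Ω) {q : ℕ}
    {w : Sp d → ℝ} (hw : w ∈ T.femSpace q) : ∃ L : ℝ≥0, LipschitzWith L w := by
  obtain ⟨hwc, hw0, hwp⟩ := hw
  have hel : ∀ s : T.elements, ∃ L : ℝ≥0,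
      LipschitzOnWith L w (convexHull ℝ ((s : Finset (Sp d)) : Set (Sp d))) := by
    rintro ⟨s, hs⟩
    obtain ⟨p, -, hp⟩ := hwp s hs
    have hcd : ContDiff ℝ 1 fun x : Sp d => MvPolynomial.eval (fun i => x i) p := by
      have h1 : ContDiff ℝ 1 fun y : Fin d → ℝ => MvPolynomial.eval y p :=
        contDiff_iff_contDiffAt.2 fun x =>
          (AnalyticOnNhd.eval_mvPolynomial (𝕜 := ℝ) p x (mem_univ _)).contDiffAt
      exact h1.comp (by fun_prop : ContDiff ℝ 1 fun x : Sp d => fun i => x i)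
    obtain ⟨L, hL⟩ := hcd.contDiffOn.exists_lipschitzOnWith one_ne_zero
      (convex_convexHull ℝ (s : Set (Sp d))) (s.finite_toSet.isCompact_convexHull ℝ)
    exact ⟨L, fun x hx y hy => by rw [hp x hx, hp y hy]; exact hL hx hy⟩
  choose L hL using hel
  -- The index `none` stands for the complement of Ω, where w vanishes; together with the elements
  -- it covers the whole space. The sum serves as a common upper bound of the constants.
  refine ⟨∑ s, L s, LipschitzWith.of_finite_closed_cover (ι := Option T.elements)
    (F := fun o => o.elim Ωᶜ fun s => convexHull ℝ ((s : Finset (Sp d)) : Set (Sp d)))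
    ?_ ?_ hwc ?_⟩
  · rintro (_ | s)
    · exact hΩ.isClosed_compl
    · exact (s : Finset (Sp d)).finite_toSet.isClosed_convexHull ℝ
  · intro x
    by_cases hx : x ∈ Ω
    · obtain ⟨s, hs, hxs⟩ := T.exists_element (subset_closure hx)
      exact ⟨some ⟨s, hs⟩, hxs⟩
    · exact ⟨none, hx⟩
  · rintro (_ | s)
    · intro x hx y hy
      rw [hw0 x hx, hw0 y hy]
      simp
    · exact (hL s).weaken (Finset.single_le_sum (fun _ _ => zero_le) (Finset.mem_univ s))

end Triangulation

end DeepRitzFE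

/-! ### Weak gradients of Lipschitz functions and Poincaré's inequality -/

namespace DeepRitzFE

variable {d : ℕ} {Ω : Set (Sp d)}

/-- The vector of the partial derivatives of `u`. -/
def partialGrad (u : Sp d → ℝ) (x : Sp d) : Sp d :=
  WithLp.toLp 2 fun i => lineDeriv ℝ u x (EuclideanSpace.single i 1)

theorem partialGrad_apply (u : Sp d → ℝ) (x : Sp d) (i : Fin d) :
    partialGrad u x i = lineDeriv ℝ u x (EuclideanSpace.single i 1) := rfl

theorem measurable_partialGrad {u : Sp d → ℝ} (hu : Continuous u) :
    Measurable (partialGrad u) := by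
  have : Measurable fun x => fun i : Fin d => lineDeriv ℝ u x (EuclideanSpace.single i 1) :=
    measurable_pi_lambda _ fun i => measurable_lineDeriv hu
  exact (WithLp.measurable_toLp 2 _).comp this

/-- The bound holds at every point and not just almost everywhere, because `lineDeriv` is 0 where
the derivative does not exist. -/
theorem exists_norm_partialGrad_le {u : Sp d → ℝ} {L : ℝ≥0} (hu : LipschitzWith L u) :
    ∃ B, ∀ x, ‖partialGrad u x‖ ≤ B := by
  refine ⟨√(∑ _i : Fin d, (L : ℝ) ^ 2), fun x => ?_⟩
  rw [EuclideanSpace.norm_eq]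
  refine Real.sqrt_le_sqrt (Finset.sum_le_sum fun i _ => ?_)
  rw [partialGrad_apply]
  gcongr
  simpa using norm_lineDeriv_le_of_lipschitz ℝ hu (x₀ := x) (v := EuclideanSpace.single i (1 : ℝ))

theorem memLp_partialGrad {u : Sp d → ℝ} {L : ℝ≥0} (hu : LipschitzWith L u)
    (μ : Measure (Sp d)) [IsFiniteMeasure μ] : MemLp (partialGrad u) 2 μ := by
  obtain ⟨B, hB⟩ := exists_norm_partialGrad_le hu
  exact MemLp.of_bound (measurable_partialGrad hu.continuous).aestronglyMeasurable B
    (Eventually.of_forall hB)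

/-- The partial derivatives of a Lipschitz function form a weak gradient. -/
theorem hasWeakGrad_partialGrad {u : Sp d → ℝ} {L : ℝ≥0}
    (hu : LipschitzWith L u) : HasWeakGrad Ω u (partialGrad u) := by
  refine ⟨hu.continuous.locallyIntegrable.locallyIntegrableOn _, ?_, fun φ hφ hφc hφΩ i => ?_⟩
  · obtain ⟨B, hB⟩ := exists_norm_partialGrad_le hu
    exact ((memLp_top_of_bound (measurable_partialGrad hu.continuous).aestronglyMeasurable B
      (Eventually.of_forall hB)).locallyIntegrable le_top).locallyIntegrableOn _
  · obtain ⟨D, hD⟩ := hφ.lipschitzWith_of_hasCompactSupport hφc (by simp)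
    -- The test function is supported in Ω, so both integrals extend to ℝ^d, where a Lipschitz
    -- function can be integrated by parts against it.
    rw [setIntegral_eq_integral_of_forall_compl_eq_zero,
      setIntegral_eq_integral_of_forall_compl_eq_zero]
    · have h := hu.integral_lineDeriv_mul_eq (μ := volume) hD hφc (EuclideanSpace.single i (1 : ℝ))
      simp only [partialGrad_apply]
      rw [h, ← integral_neg]
      refine integral_congr_ae (Eventually.of_forall fun x => ?_)
      dsimp only
      rw [((hφ.differentiable (by simp)) x).lineDeriv_eq_fderiv, map_neg]
      ring
    · intro x hx
      rw [image_eq_zero_of_notMem_tsupport fun h => hx (hφΩ h), mul_zero]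
    · intro x hx
      rw [image_eq_zero_of_notMem_tsupport
        fun h => hx (hφΩ (tsupport_fderiv_subset ℝ h)), _root_.zero_apply, mul_zero]

/-- Weak gradients are unique almost everywhere. -/
theorem HasWeakGrad.ae_eq (hΩ : IsOpen Ω) {u : Sp d → ℝ} {G G' : Sp d → Sp d}
    (h : HasWeakGrad Ω u G) (h' : HasWeakGrad Ω u G') :
    ∀ᵐ x ∂volume.restrict Ω, G x = G' x := by
  have hcoord : ∀ {H : Sp d → Sp d}, LocallyIntegrableOn H Ω → ∀ i,
      LocallyIntegrableOn (fun x => H x i) Ω := fun hH i x hx => by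
    obtain ⟨s, hs, hsi⟩ := hH x hx
    exact ⟨s, hs, (EuclideanSpace.proj (𝕜 := ℝ) i).integrable_comp hsi⟩
  have hint : ∀ {H : Sp d → Sp d}, LocallyIntegrableOn H Ω → ∀ i, ∀ φ : Sp d → ℝ, Continuous φ →
      HasCompactSupport φ → tsupport φ ⊆ Ω → Integrable fun x => H x i * φ x := by
    intro H hH i φ hφ hφc hφΩ
    have h1 : IntegrableOn (fun x => H x i) (tsupport φ) :=
      (hcoord hH i).integrableOn_compact_subset hφΩ hφc
    have h2 : IntegrableOn (fun x => H x i * φ x) (tsupport φ) :=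
      h1.mul_continuousOn hφ.continuousOn hφc
    refine (integrableOn_iff_integrable_of_support_subset fun x hx => ?_).1 h2
    exact subset_tsupport _ (right_ne_zero_of_mul hx)
  -- The fundamental lemma of the calculus of variations, applied to each coordinate of G - G'.
  have key : ∀ i, ∀ᵐ x ∂volume, x ∈ Ω → G x i - G' x i = 0 := fun i => by
    refine hΩ.ae_eq_zero_of_integral_contDiff_smul_eq_zero
      ((hcoord h.2.1 i).sub (hcoord h'.2.1 i)) fun φ hφ hφc hφΩ => ?_
    have e := (neg_inj.1 ((h.2.2 φ hφ hφc hφΩ i).symm.trans (h'.2.2 φ hφ hφc hφΩ i)))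
    have hz : ∀ x, x ∉ Ω → φ x = 0 := fun x hx =>
      image_eq_zero_of_notMem_tsupport fun h => hx (hφΩ h)
    rw [setIntegral_eq_integral_of_forall_compl_eq_zero (fun x hx => by rw [hz x hx, mul_zero]),
      setIntegral_eq_integral_of_forall_compl_eq_zero (fun x hx => by rw [hz x hx, mul_zero])] at e
    have e2 := integral_sub (hint h.2.1 i φ hφ.continuous hφc hφΩ)
      (hint h'.2.1 i φ hφ.continuous hφc hφΩ)
    rw [e, sub_self] at e2
    rw [← e2]
    refine integral_congr_ae (Eventually.of_forall fun x => ?_)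
    simp only [smul_eq_mul]
    ring
  rw [ae_restrict_iff' hΩ.measurableSet]
  filter_upwards [ae_all_iff.2 key] with x hx hxΩ
  ext i
  exact sub_eq_zero.1 (hx i hxΩ)

/-- `weakGrad` is an arbitrary choice, determined only up to null sets; this allows the explicit
`partialGrad` to replace it under integrals. -/
theorem HasWeakGrad.weakGrad_ae_eq (hΩ : IsOpen Ω) {u : Sp d → ℝ} {G : Sp d → Sp d}
    (h : HasWeakGrad Ω u G) : ∀ᵐ x ∂volume.restrict Ω, weakGrad Ω u x = G x := by
  have hex : ∃ G, HasWeakGrad Ω u G := ⟨G, h⟩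
  rw [weakGrad, dif_pos hex]
  exact hex.choose_spec.ae_eq hΩ h

theorem isFiniteMeasure_restrict_of_isBounded (hb : Bornology.IsBounded Ω) :
    IsFiniteMeasure (volume.restrict Ω) :=
  isFiniteMeasure_restrict.2 hb.measure_lt_top.ne

theorem integral_norm_weakGrad_sq (hΩ : IsOpen Ω) {u : Sp d → ℝ} {L : ℝ≥0}
    (hu : LipschitzWith L u) :
    ∫ x in Ω, ‖weakGrad Ω u x‖ ^ 2 = ∫ x in Ω, ‖partialGrad u x‖ ^ 2 := by
  refine integral_congr_ae ?_
  filter_upwards [(hasWeakGrad_partialGrad hu).weakGrad_ae_eq hΩ] with x hx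
  rw [hx]

theorem exists_abs_le_of_continuous {u : Sp d → ℝ} (hu : Continuous u)
    (hb : Bornology.IsBounded Ω) (hu0 : ∀ x, x ∉ Ω → u x = 0) : ∃ M, ∀ x, |u x| ≤ M := by
  have hc : HasCompactSupport u := HasCompactSupport.of_support_subset_isCompact
    hb.isCompact_closure fun x hx => subset_closure (by_contra fun h => hx (hu0 x h))
  exact hc.exists_bound_of_continuous hu

/-- A Lipschitz function on a bounded open set belongs to `H¹`. -/
theorem memH1_of_lipschitzWith (hb : Bornology.IsBounded Ω) {u : Sp d → ℝ} {L : ℝ≥0}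
    (hu : LipschitzWith L u) (hu0 : ∀ x, x ∉ Ω → u x = 0) : MemH1 Ω u := by
  have := isFiniteMeasure_restrict_of_isBounded hb
  obtain ⟨M, hM⟩ := exists_abs_le_of_continuous hu.continuous hb hu0
  exact ⟨MemLp.of_bound hu.continuous.aestronglyMeasurable M (Eventually.of_forall hM),
    partialGrad u, hasWeakGrad_partialGrad hu, memLp_partialGrad hu _⟩

/-- Poincaré's inequality for Lipschitz functions which vanish outside a bounded open set. -/
theorem integral_sq_le_of_lipschitzWith (hd : 1 ≤ d) (hΩ : IsOpen Ω) {R : ℝ}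
    (hR : ∀ x ∈ Ω, ‖x‖ ≤ R) {u : Sp d → ℝ} {L : ℝ≥0} (hu : LipschitzWith L u)
    (hu0 : ∀ x, x ∉ Ω → u x = 0) :
    ∫ x in Ω, u x ^ 2 ≤ 4 * R ^ 2 * ∫ x in Ω, ‖partialGrad u x‖ ^ 2 := by
  have hb : Bornology.IsBounded Ω := isBounded_iff_forall_norm_le.2 ⟨R, hR⟩
  have := isFiniteMeasure_restrict_of_isBounded hb
  obtain ⟨M, hM⟩ := exists_abs_le_of_continuous hu.continuous hb hu0
  let i : Fin d := ⟨0, hd⟩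
  let e : Sp d := EuclideanSpace.single i 1
  have hsq : LipschitzWith (2 * M.toNNReal * L) fun x => u x ^ 2 := by
    refine LipschitzWith.of_dist_le_mul fun x y => ?_
    have hM0 : 0 ≤ M := (abs_nonneg _).trans (hM x)
    have h1 := hu.dist_le_mul x y
    rw [Real.dist_eq] at h1 ⊢
    have h2 : |u x + u y| ≤ 2 * M := by
      have := (abs_add_le (u x) (u y)).trans (add_le_add (hM x) (hM y))
      linarith
    have h3 : u x ^ 2 - u y ^ 2 = (u x + u y) * (u x - u y) := by ring
    rw [h3, abs_mul]
    push_cast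
    rw [Real.coe_toNNReal _ hM0, mul_assoc]
    gcongr
  have hsqc : HasCompactSupport fun x => u x ^ 2 := HasCompactSupport.of_support_subset_isCompact
    hb.isCompact_closure fun x hx => subset_closure (by_contra fun h => hx (by simp [hu0 x h]))
  obtain ⟨D, hD⟩ : ∃ D : ℝ≥0, LipschitzWith D fun x : Sp d => x i :=
    ⟨_, (EuclideanSpace.proj (𝕜 := ℝ) i).lipschitz⟩
  -- The coordinate x_i has derivative 1 in the direction e, so integrating it by parts against u²
  -- gives ∫ u² = -∫ 2 u ∂ᵢu x_i.
  have hparts := hD.integral_lineDeriv_mul_eq (μ := volume) hsq hsqc e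
  have hl : ∀ x : Sp d, lineDeriv ℝ (fun x : Sp d => x i) x e = 1 := fun x => by
    have h := (EuclideanSpace.proj (𝕜 := ℝ) i : Sp d →L[ℝ] ℝ).hasFDerivAt (x := x)
    have h2 := (h.hasLineDerivAt e).lineDeriv
    simpa [e] using h2
  simp only [hl, one_mul] at hparts
  have hae : ∀ᵐ x, lineDeriv ℝ (fun x => u x ^ 2) x (-e) * x i
      = -(2 * u x * partialGrad u x i * x i) := by
    filter_upwards [hu.ae_lineDifferentiableAt e] with x hx
    have h1 : HasLineDerivAt ℝ (fun x => u x ^ 2) (2 * u x * lineDeriv ℝ u x e) x e := by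
      have h : HasDerivAt (fun t : ℝ => u (x + t • e)) (lineDeriv ℝ u x e) 0 := hx.hasLineDerivAt
      simpa [HasLineDerivAt] using h.fun_pow 2
    rw [lineDeriv_neg, h1.lineDeriv, partialGrad_apply]
    ring
  have hs : ∫ x in Ω, u x ^ 2 = ∫ x, u x ^ 2 :=
    setIntegral_eq_integral_of_forall_compl_eq_zero fun x hx => by rw [hu0 x hx]; ring
  have hs' : ∫ x in Ω, -(2 * u x * partialGrad u x i * x i)
      = ∫ x, -(2 * u x * partialGrad u x i * x i) :=
    setIntegral_eq_integral_of_forall_compl_eq_zero fun x hx => by rw [hu0 x hx]; ring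
  rw [integral_congr_ae hae, ← hs, ← hs'] at hparts
  have hi1 : Integrable (fun x => u x ^ 2) (volume.restrict Ω) :=
    (hsq.continuous.integrable_of_hasCompactSupport hsqc).restrict
  have hi2 : Integrable (fun x => ‖partialGrad u x‖ ^ 2) (volume.restrict Ω) :=
    (memLp_partialGrad hu _).integrable_norm_pow (by norm_num)
  -- Young's inequality with |x_i| ≤ R, weighted so that half of ∫ u² is absorbed on the left; this
  -- produces the constant 4 R².
  have hpt : ∀ x ∈ Ω, |2 * u x * partialGrad u x i * x i|
      ≤ 1 / 2 * u x ^ 2 + 2 * R ^ 2 * ‖partialGrad u x‖ ^ 2 := by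
    intro x hx
    have h1 : |x i| ≤ R := (PiLp.norm_apply_le x i).trans (hR x hx)
    have h2 : |partialGrad u x i| ≤ ‖partialGrad u x‖ := PiLp.norm_apply_le (partialGrad u x) i
    have h3 : |partialGrad u x i| * |x i| ≤ ‖partialGrad u x‖ * R := by gcongr
    rw [abs_mul, abs_mul, abs_mul, abs_two, ← sq_abs (u x)]
    nlinarith [sq_nonneg (|u x| - 2 * R * ‖partialGrad u x‖),
      mul_le_mul_of_nonneg_left h3 (abs_nonneg (u x))]
  have hi3 : Integrable (fun x => 1 / 2 * u x ^ 2 + 2 * R ^ 2 * ‖partialGrad u x‖ ^ 2)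
      (volume.restrict Ω) := (hi1.const_mul _).add (hi2.const_mul _)
  have hle : ∫ x in Ω, u x ^ 2
      ≤ ∫ x in Ω, (1 / 2 * u x ^ 2 + 2 * R ^ 2 * ‖partialGrad u x‖ ^ 2) := by
    rw [hparts]
    refine (Real.le_norm_self _).trans ?_
    refine norm_integral_le_of_norm_le hi3 ?_
    filter_upwards [ae_restrict_mem hΩ.measurableSet] with x hx
    rw [norm_neg]
    exact hpt x hx
  rw [integral_add (hi1.const_mul _) (hi2.const_mul _), integral_const_mul,
    integral_const_mul] at hle
  linarith

end DeepRitzFE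

/-! ### L¹ stability of coefficientwise multiplication -/

/-- On a finite-dimensional space of integrable functions the `L¹` norm controls the coefficients:
replacing the coefficients `c` by `c'` with `|c'| ≤ F |c|` increases the `L¹` norm at most by a
constant factor. -/
theorem MeasureTheory.exists_integral_abs_sum_mul_le {X κ : Type*} [MeasurableSpace X] [Fintype κ]
    {μ : Measure X} {ψ : κ → X → ℝ} (hψ : ∀ k, Integrable (ψ k) μ)
    (hli : ∀ c : κ → ℝ, (∀ᵐ x ∂μ, ∑ k, c k * ψ k x = 0) → c = 0) :
    ∃ B : ℝ, 0 ≤ B ∧ ∀ (c c' : κ → ℝ) (F : ℝ), 0 ≤ F → (∀ k, |c' k| ≤ F * |c k|) →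
      ∫ x, |∑ k, c' k * ψ k x| ∂μ ≤ B * F * ∫ x, |∑ k, c k * ψ k x| ∂μ := by
  have hi : ∀ c : κ → ℝ, Integrable (fun x => ∑ k, c k * ψ k x) μ := fun c =>
    integrable_finsetSum _ fun k _ => (hψ k).const_mul _
  -- The coefficient map into L¹ is linear and, by independence, injective; on a finite-dimensional
  -- domain it is then bounded above and below. With the maximum norm on coefficients, passing from
  -- c to c' costs the factor F.
  let Φ : (κ → ℝ) →ₗ[ℝ] (X →₁[μ] ℝ) :=
    { toFun := fun c => (hi c).toL1 _
      map_add' := fun c c' => by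
        rw [← Integrable.toL1_add, Integrable.toL1_eq_toL1_iff]
        refine Eventually.of_forall fun x => ?_
        simp [add_mul, Finset.sum_add_distrib]
      map_smul' := fun a c => by
        rw [RingHom.id_apply, ← Integrable.toL1_smul', Integrable.toL1_eq_toL1_iff]
        refine Eventually.of_forall fun x => ?_
        simp [Finset.mul_sum, mul_assoc] }
  have hnorm : ∀ c, ‖Φ c‖ = ∫ x, |∑ k, c k * ψ k x| ∂μ := fun c =>
    L1.norm_of_fun_eq_integral_norm (hi c)
  have hker : LinearMap.ker Φ = ⊥ := by
    refine LinearMap.ker_eq_bot'.2 fun c hc => hli c ?_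
    have h0 : (hi c).toL1 _ = (integrable_zero X ℝ μ).toL1 _ := by
      rw [Integrable.toL1_zero]
      exact hc
    exact (Integrable.toL1_eq_toL1_iff _ _ _ _).1 h0
  obtain ⟨K, -, hK⟩ := Φ.exists_antilipschitzWith hker
  refine ⟨‖Φ.toContinuousLinearMap‖ * K, by positivity, fun c c' F hF h => ?_⟩
  rw [← hnorm, ← hnorm]
  have h1 : ‖c'‖ ≤ F * ‖c‖ := by
    refine (pi_norm_le_iff_of_nonneg (by positivity)).2 fun k => ?_
    exact (h k).trans (mul_le_mul_of_nonneg_left (norm_le_pi_norm c k) hF)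
  have h2 : ‖c‖ ≤ K * ‖Φ c‖ := ZeroHomClass.bound_of_antilipschitz Φ hK c
  calc ‖Φ c'‖ ≤ ‖Φ.toContinuousLinearMap‖ * ‖c'‖ := Φ.toContinuousLinearMap.le_opNorm c'
    _ ≤ ‖Φ.toContinuousLinearMap‖ * (F * (K * ‖Φ c‖)) := by gcongr; exact h1.trans (by gcongr)
    _ = ‖Φ.toContinuousLinearMap‖ * K * F * ‖Φ c‖ := by ring

/-! ### Shape functions on a simplex and transport to a reference simplex -/

namespace DeepRitzFE

variable {d : ℕ}

/-- The multi-indices of length `q` on the vertices of a `d`-simplex. -/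
abbrev MultiIndex (d q : ℕ) : Type := {α : Fin (d + 1) → ℕ // α ∈ Finset.univ.piAntidiag q}

theorem MultiIndex.sum_eq {q : ℕ} (α : MultiIndex d q) : ∑ i, α.1 i = q :=
  (Finset.mem_piAntidiag.1 α.2).1

/-- The Lagrange shape function as a function of the barycentric coordinates. -/
def shape (q : ℕ) (α : Fin (d + 1) → ℕ) (lam : Fin (d + 1) → ℝ) : ℝ :=
  ∏ i, ∏ j ∈ Finset.range (α i), (q * lam i - j) / (j + 1)

theorem continuous_shape (q : ℕ) (α : Fin (d + 1) → ℕ) : Continuous (shape q α) := by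
  unfold shape
  fun_prop

/-- Distinct multi-indices of equal length satisfy β i < α i for some i, and then the factor j = β i
vanishes. For α = β each inner product is (α i)! / (α i)! = 1. -/
theorem shape_apply {q : ℕ} (hq : 1 ≤ q) (α β : MultiIndex d q) :
    shape q α.1 (fun i => (β.1 i : ℝ) / q) = if α = β then 1 else 0 := by
  have hq0 : (q : ℝ) ≠ 0 := by positivity
  have hc : ∀ i, (q : ℝ) * ((β.1 i : ℝ) / q) = β.1 i := fun i => by field_simp
  simp only [shape, hc]
  split_ifs with h
  · subst h
    refine Finset.prod_eq_one fun i _ => ?_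
    rw [Finset.prod_div_distrib, Finset.prod_range_natCast_sub, ← Nat.descFactorial_eq_prod_range,
      Nat.descFactorial_self]
    have : ∏ j ∈ Finset.range (α.1 i), ((j : ℝ) + 1) = ((α.1 i).factorial : ℝ) := by
      rw [← Finset.prod_range_add_one_eq_factorial]
      push_cast
      rfl
    rw [this, div_self (by positivity)]
  · obtain ⟨i, hi⟩ : ∃ i, β.1 i < α.1 i := by
      by_contra! hcon
      have := (Finset.sum_eq_sum_iff_of_le fun i (_ : i ∈ Finset.univ) => hcon i).1
        (α.sum_eq.trans β.sum_eq.symm)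
      exact h (Subtype.ext (funext fun i => this i (Finset.mem_univ i)))
    exact Finset.prod_eq_zero (Finset.mem_univ i)
      (Finset.prod_eq_zero (Finset.mem_range.2 hi) (by simp))

/-- The closed simplex spanned by an affine basis. -/
abbrev simplex (b : AffineBasis (Fin (d + 1)) ℝ (Sp d)) : Set (Sp d) := convexHull ℝ (range b)

theorem isCompact_simplex (b : AffineBasis (Fin (d + 1)) ℝ (Sp d)) : IsCompact (simplex b) :=
  (finite_range b).isCompact_convexHull ℝ

theorem continuous_coords (b : AffineBasis (Fin (d + 1)) ℝ (Sp d)) : Continuous b.coords :=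
  b.coords.continuous_of_finiteDimensional

/-- The Lagrange point of the simplex of `b` with barycentric coordinates `α / q`. -/
def latticePoint (q : ℕ) (b : AffineBasis (Fin (d + 1)) ℝ (Sp d)) (α : Fin (d + 1) → ℕ) : Sp d :=
  ∑ i, ((α i : ℝ) / q) • b i

theorem sum_div_eq_one {q : ℕ} (hq : 1 ≤ q) (α : MultiIndex d q) :
    ∑ i, (α.1 i : ℝ) / q = 1 := by
  rw [← Finset.sum_div, ← Nat.cast_sum, α.sum_eq, div_self (by positivity)]

theorem coord_sum_smul (b : AffineBasis (Fin (d + 1)) ℝ (Sp d)) {w : Fin (d + 1) → ℝ}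
    (hw : ∑ i, w i = 1) (i : Fin (d + 1)) : b.coord i (∑ i, w i • b i) = w i := by
  rw [← Finset.affineCombination_eq_linear_combination _ _ _ hw]
  exact b.coord_apply_combination_of_mem (Finset.mem_univ _) hw

theorem coord_latticePoint {q : ℕ} (hq : 1 ≤ q) (b : AffineBasis (Fin (d + 1)) ℝ (Sp d))
    (α : MultiIndex d q) (i : Fin (d + 1)) :
    b.coord i (latticePoint q b α.1) = (α.1 i : ℝ) / q :=
  coord_sum_smul b (sum_div_eq_one hq α) i

theorem latticePoint_mem_simplex {q : ℕ} (hq : 1 ≤ q) (b : AffineBasis (Fin (d + 1)) ℝ (Sp d))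
    (α : MultiIndex d q) : latticePoint q b α.1 ∈ simplex b := by
  rw [simplex, b.convexHull_eq_nonneg_coord]
  intro i
  rw [coord_latticePoint hq]
  positivity

/-- The stability of the coefficientwise multiplication in the Lagrange basis of a fixed
simplex. -/
theorem exists_integral_shape_le {q : ℕ} (hq : 1 ≤ q) (b : AffineBasis (Fin (d + 1)) ℝ (Sp d)) :
    ∃ B : ℝ, 0 ≤ B ∧ ∀ (c c' : MultiIndex d q → ℝ) (F : ℝ), 0 ≤ F → (∀ α, |c' α| ≤ F * |c α|) →
      ∫ x in simplex b, |∑ α, c' α * shape q α.1 (b.coords x)|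
        ≤ B * F * ∫ x in simplex b, |∑ α, c α * shape q α.1 (b.coords x)| := by
  have hc : ∀ α : MultiIndex d q, Continuous fun x => shape q α.1 (b.coords x) := fun α =>
    (continuous_shape q α.1).comp (continuous_coords b)
  refine exists_integral_abs_sum_mul_le
    (fun α => (hc α).continuousOn.integrableOn_compact (isCompact_simplex b)) fun c hc0 => ?_
  have hcv : Convex ℝ (simplex b) := convex_convexHull ℝ _
  have hint : (interior (simplex b)).Nonempty :=
    interior_convexHull_nonempty_iff_affineSpan_eq_top.2 b.tot
  -- A simplex lies in the closure of its interior, so a continuous function vanishing almost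
  -- everywhere on it vanishes everywhere on it; evaluation at the lattice points then recovers each
  -- coefficient.
  have heq := Measure.eqOn_of_ae_eq (g := fun _ => (0 : ℝ)) hc0
    (continuous_finsetSum _ fun α _ => continuous_const.mul (hc α)).continuousOn
    continuousOn_const
    (by rw [hcv.closure_interior_eq_closure_of_nonempty_interior hint]; exact subset_closure)
  funext β
  have h := heq (latticePoint_mem_simplex hq b β)
  have hβ : b.coords (latticePoint q b β.1) = fun i => (β.1 i : ℝ) / q :=
    funext fun i => coord_latticePoint hq b β i
  simpa [hβ, shape_apply hq] using h

/-- Integrals of functions of the barycentric coordinates over two simplices agree up to a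
factor. -/
theorem exists_integral_simplex_eq (b₀ b : AffineBasis (Fin (d + 1)) ℝ (Sp d)) :
    ∃ D : ℝ, 0 ≤ D ∧ ∀ h : (Fin (d + 1) → ℝ) → ℝ,
      ∫ x in simplex b, h (b.coords x) = D * ∫ y in simplex b₀, h (b₀.coords y) := by
  -- The affine map taking each b₀ i to b i preserves barycentric coordinates, so the change of
  -- variables leaves h untouched and D is |det A|, independent of h.
  let A : Sp d →ᵃ[ℝ] Sp d := (Fintype.linearCombination ℝ b).toAffineMap.comp b₀.coords
  have hA : ∀ y, A y = ∑ i, b₀.coord i y • b i := fun y => rfl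
  have hAc : ∀ y, b.coords (A y) = b₀.coords y := fun y => by
    funext i
    exact coord_sum_smul b (b₀.sum_coord_apply_eq_one y) i
  have hinj : Function.Injective A := fun y z hyz => by
    refine b₀.ext_elem fun i => ?_
    have := congrFun ((hAc y).symm.trans ((congrArg b.coords hyz).trans (hAc z))) i
    exact this
  have hb : ∀ i, A (b₀ i) = b i := fun i => by
    refine b.ext_elem fun j => ?_
    have := congrFun (hAc (b₀ i)) j
    simpa [AffineBasis.coord_apply] using this
  have him : simplex b = A '' simplex b₀ := by
    rw [simplex, simplex, A.image_convexHull, ← range_comp]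
    congr 2
    exact funext fun i => (hb i).symm
  have hderiv : ∀ y, HasFDerivAt A (LinearMap.toContinuousLinearMap A.linear) y := fun y => by
    rw [A.decomp]
    exact (LinearMap.toContinuousLinearMap A.linear).hasFDerivAt.add_const _
  refine ⟨|(LinearMap.toContinuousLinearMap A.linear).det|, abs_nonneg _, fun h => ?_⟩
  rw [him, integral_image_eq_integral_abs_det_fderiv_smul volume
    (isCompact_simplex b₀).measurableSet (fun y _ => (hderiv y).hasFDerivWithinAt) hinj.injOn]
  simp only [hAc, smul_eq_mul]
  exact integral_const_mul _ _

/-- The stability constant depends only on the dimension and the degree. -/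
theorem exists_integral_shape_le_uniform (d : ℕ) {q : ℕ} (hq : 1 ≤ q) :
    ∃ B : ℝ, 0 ≤ B ∧ ∀ (b : AffineBasis (Fin (d + 1)) ℝ (Sp d)) (c c' : MultiIndex d q → ℝ)
      (F : ℝ), 0 ≤ F → (∀ α, |c' α| ≤ F * |c α|) →
      ∫ x in simplex b, |∑ α, c' α * shape q α.1 (b.coords x)|
        ≤ B * F * ∫ x in simplex b, |∑ α, c α * shape q α.1 (b.coords x)| := by
  obtain ⟨b₀⟩ : Nonempty (AffineBasis (Fin (d + 1)) ℝ (Sp d)) :=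
    AffineBasis.exists_affineBasis_of_finiteDimensional (by simp)
  obtain ⟨B, hB, h⟩ := exists_integral_shape_le hq b₀
  refine ⟨B, hB, fun b c c' F hF hc => ?_⟩
  obtain ⟨D, hD, hint⟩ := exists_integral_simplex_eq b₀ b
  -- Both sides carry the same factor D, so the constant of the reference simplex b₀ serves for
  -- every simplex.
  rw [hint fun lam => |∑ α, c' α * shape q α.1 lam|, hint fun lam => |∑ α, c α * shape q α.1 lam|,
    mul_left_comm]
  exact mul_le_mul_of_nonneg_left (h c c' F hF hc) hD

end DeepRitzFE

/-! ### The interpolant on a single element, and sums over elements -/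

namespace DeepRitzFE

namespace Triangulation

variable {d : ℕ} {Ω : Set (Sp d)}

/-- The vertices of an element can be numbered to form an affine basis. -/
theorem exists_affineBasis (T : Triangulation Ω) {s : Finset (Sp d)} (hs : s ∈ T.elements) :
    ∃ b : AffineBasis (Fin (d + 1)) ℝ (Sp d), range b = s := by
  obtain ⟨hf, hc⟩ := mem_elements.1 hs
  have htop : affineSpan ℝ (range ((↑) : s → Sp d)) = ⊤ := by
    rw [(T.indep hf).affineSpan_eq_top_iff_card_eq_finrank_add_one]
    simp [hc]
  let b : AffineBasis s ℝ (Sp d) := ⟨(↑), T.indep hf, htop⟩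
  refine ⟨b.reindex (s.equivFinOfCardEq hc), ?_⟩
  rw [AffineBasis.coe_reindex, (Equiv.surjective _).range_comp]
  exact Subtype.range_coe

section Element

variable {s : Finset (Sp d)} {b : AffineBasis (Fin (d + 1)) ℝ (Sp d)}

theorem simplex_eq (hb : range b = s) : simplex b = convexHull ℝ (s : Set (Sp d)) := by
  rw [simplex, hb]

theorem basis_mem (hb : range b = s) (i : Fin (d + 1)) : b i ∈ s := by
  rw [← Finset.mem_coe, ← hb]
  exact mem_range_self i

open Classical in
theorem image_basis (hb : range b = s) : Finset.univ.image b = s := by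
  rw [← Finset.coe_inj, Finset.coe_image, Finset.coe_univ, image_univ, hb]

theorem sum_vertices {M : Type*} [AddCommMonoid M] (hb : range b = s) (g : Sp d → M) :
    ∑ a ∈ s, g a = ∑ i, g (b i) := by
  classical
  rw [← image_basis hb, Finset.sum_image fun i _ j _ h => b.ind.injective h]

theorem prod_vertices (hb : range b = s) (g : Sp d → ℝ) :
    ∏ a ∈ s, g a = ∏ i, g (b i) := by
  classical
  rw [← image_basis hb, Finset.prod_image fun i _ j _ h => b.ind.injective h]

theorem bary_eq_coord (T : Triangulation Ω) (hs : s ∈ T.elements) (hb : range b = s) {x : Sp d}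
    (hx : x ∈ simplex b) (i : Fin (d + 1)) : T.bary x (b i) = b.coord i x := by
  rw [simplex_eq hb] at hx
  obtain ⟨-, -, h1, h2⟩ := T.bary_spec (mem_elements.1 hs).1 hx
  rw [sum_vertices hb] at h1 h2
  conv_rhs => rw [← h2]
  exact (coord_sum_smul b h1 i).symm

/-- The global product runs over all vertices of the mesh, but at a vertex outside s the coordinate
of the node is 0 and the inner product is empty. Only the vertices of s remain, where the mesh
coordinates are those of b. -/
theorem lagrange_latticePoint (T : Triangulation Ω) {q : ℕ} (hq : 1 ≤ q) (hs : s ∈ T.elements)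
    (hb : range b = s) (α : MultiIndex d q) {x : Sp d} (hx : x ∈ simplex b) :
    T.lagrange q (latticePoint q b α.1) x = shape q α.1 (b.coords x) := by
  have hz := latticePoint_mem_simplex hq b α
  have hsv : s ⊆ T.verts := by
    classical
    exact Finset.subset_biUnion_of_mem id hs
  have hq0 : (q : ℝ) ≠ 0 := by positivity
  rw [lagrange, ← Finset.prod_subset hsv, prod_vertices hb, shape]
  · refine Finset.prod_congr rfl fun i _ => ?_
    rw [T.bary_eq_coord hs hb hz, T.bary_eq_coord hs hb hx, coord_latticePoint hq,
      mul_div_cancel₀ _ hq0, Nat.floor_natCast, AffineBasis.coords_apply]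
  · intro a _ ha
    have := (T.bary_spec (mem_elements.1 hs).1 (simplex_eq hb ▸ hz)).2.1 a ha
    simp [this]

theorem latticePoint_mem_nodes (T : Triangulation Ω) {q : ℕ} (hs : s ∈ T.elements)
    (hb : range b = s) (α : MultiIndex d q) (hz : latticePoint q b α.1 ∈ Ω) :
    latticePoint q b α.1 ∈ T.nodes q := by
  classical
  refine Finset.mem_filter.2 ⟨Finset.mem_biUnion.2 ⟨s, hs, Finset.mem_image.2 ?_⟩, hz⟩
  have hinj := b.ind.injective
  have hext : ∀ i, Function.extend b α.1 0 (b i) = α.1 i := fun i => hinj.extend_apply _ _ _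
  refine ⟨Function.extend b α.1 0, Finset.mem_piAntidiag.2 ⟨?_, fun a ha => ?_⟩, ?_⟩
  · rw [sum_vertices hb]
    simp only [hext, α.sum_eq]
  · by_contra has
    refine ha (Function.extend_apply' _ _ _ ?_)
    rintro ⟨i, rfl⟩
    exact has (basis_mem hb i)
  · rw [sum_vertices hb fun a => ((Function.extend b α.1 0 a : ℕ) / (q : ℝ)) • a]
    simp only [hext, latticePoint]

/-- Such a node has a nonzero coordinate at some vertex a outside s, as otherwise it would be a
lattice point of s. On the simplex of s the coordinate at a is 0, which kills the factor j = 0. -/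
theorem lagrange_eq_zero_of_ne_latticePoint (T : Triangulation Ω) {q : ℕ} (hq : 1 ≤ q)
    (hs : s ∈ T.elements) (hb : range b = s) {z : Sp d} (hz : z ∈ T.nodes q)
    (hne : ∀ α : MultiIndex d q, latticePoint q b α.1 ≠ z) {x : Sp d} (hx : x ∈ simplex b) :
    T.lagrange q z x = 0 := by
  classical
  obtain ⟨t, ht, β, hsum, hout, hβ, hzt⟩ := T.bary_node hq hz
  have hq0 : (q : ℝ) ≠ 0 := by positivity
  obtain ⟨a, has, ha0⟩ : ∃ a, a ∉ s ∧ β a ≠ 0 := by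
    by_contra! hcon
    have hbz : ∀ a, T.bary z a = (β a : ℝ) / q := fun a => by
      rw [← hβ a]
      field_simp
    have hsub : ∀ {M : Type} [AddCommMonoid M] (g : Sp d → M), (∀ a, β a = 0 → g a = 0) →
        ∑ a ∈ t, g a = ∑ i, g (b i) := fun g hg => by
      rw [← sum_vertices hb]
      exact Finset.sum_congr_of_eq_on_inter (fun a _ h => hg a (hcon a h))
        (fun a _ h => hg a (hout a h)) fun _ _ _ => rfl
    have hα : (fun i => β (b i)) ∈ Finset.univ.piAntidiag q :=
      Finset.mem_piAntidiag.2 ⟨(hsub β fun _ h => h).symm.trans hsum, fun _ _ => Finset.mem_univ _⟩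
    refine hne ⟨_, hα⟩ ?_
    obtain ⟨-, -, -, h2⟩ := T.bary_spec (mem_elements.1 ht).1 hzt
    rw [hsub (fun a => T.bary z a • a) fun a h => by simp [hbz, h]] at h2
    conv_rhs => rw [← h2]
    simp only [latticePoint, hbz]
  have hat : a ∈ T.verts :=
    Finset.mem_biUnion.2 ⟨t, ht, by_contra fun h => ha0 (hout a h)⟩
  exact T.lagrange_eq_zero hat (hβ a) (m := 0)
    (by simp [(T.bary_spec (mem_elements.1 hs).1 (simplex_eq hb ▸ hx)).2.1 a has])
    (Nat.pos_of_ne_zero ha0)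

open Classical in
/-- The value of `u` at the Lagrange point with multi-index `α`, and `0` on the boundary. -/
def nodalValue (b : AffineBasis (Fin (d + 1)) ℝ (Sp d)) (q : ℕ) (u : C(closure Ω, ℝ))
    (α : MultiIndex d q) : ℝ :=
  if h : latticePoint q b α.1 ∈ Ω then u ⟨_, subset_closure h⟩ else 0

/-- Interpolating a product multiplies the Lagrange coefficients pointwise by values of f, which is
exactly the situation of the L¹ stability estimate. -/
theorem abs_nodalValue_mul_le (f v : C(closure Ω, ℝ)) {F : ℝ} (hF : ∀ x, |f x| ≤ F) {q : ℕ}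
    (α : MultiIndex d q) : |nodalValue b q (f * v) α| ≤ F * |nodalValue b q v α| := by
  unfold nodalValue
  split_ifs with h
  · rw [ContinuousMap.mul_apply, abs_mul]
    exact mul_le_mul_of_nonneg_right (hF _) (abs_nonneg _)
  · simp

/-- On an element the interpolant is a combination of the shape functions. -/
theorem interp_eq_sum_shape (T : Triangulation Ω) {q : ℕ} (hq : 1 ≤ q) (hs : s ∈ T.elements)
    (hb : range b = s) (u : C(closure Ω, ℝ)) {x : Sp d} (hx : x ∈ simplex b) :
    T.interp q u x = ∑ α : MultiIndex d q, nodalValue b q u α * shape q α.1 (b.coords x) := by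
  classical
  have hq0 : (q : ℝ) ≠ 0 := by positivity
  set U : Sp d → ℝ := fun z => if h : z ∈ Ω then u ⟨z, subset_closure h⟩ else 0 with hU
  have hint : T.interp q u x = ∑ z ∈ T.nodes q, U z * T.lagrange q z x := by
    rw [interp, ← Finset.sum_attach (T.nodes q)]
    refine Finset.sum_congr rfl fun z _ => ?_
    rw [hU]
    dsimp only
    rw [dif_pos (Finset.mem_filter.1 z.2).2]
  have hval : ∀ α : MultiIndex d q, nodalValue b q u α = U (latticePoint q b α.1) :=
    fun α => rfl
  -- Multi-indices whose lattice point lies off Ω have nodal value 0 and can be dropped. The rest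
  -- inject into the nodes, and the nodes not reached have basis functions vanishing on this
  -- element.
  rw [hint, ← Finset.sum_subset (Finset.filter_subset
    (fun α : MultiIndex d q => latticePoint q b α.1 ∈ Ω) Finset.univ)]
  · symm
    refine Finset.sum_of_injOn (fun α : MultiIndex d q => latticePoint q b α.1) ?_ ?_ ?_ ?_
    · intro α _ β _ h
      refine Subtype.ext (funext fun i => ?_)
      have h1 := congrArg (b.coord i) h
      rw [coord_latticePoint hq, coord_latticePoint hq, div_left_inj' hq0] at h1
      exact_mod_cast h1
    · intro α hα
      exact T.latticePoint_mem_nodes hs hb α (Finset.mem_filter.1 hα).2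
    · intro z hz hne
      rw [T.lagrange_eq_zero_of_ne_latticePoint hq hs hb hz (fun α hα => hne ⟨α, ?_, hα⟩) hx,
        mul_zero]
      exact Finset.mem_coe.2 (Finset.mem_filter.2
        ⟨Finset.mem_univ _, hα ▸ (Finset.mem_filter.1 hz).2⟩)
    · intro α _
      rw [T.lagrange_latticePoint hq hs hb α hx, hval]
  · intro α _ hα
    have : latticePoint q b α.1 ∉ Ω := fun h => hα (Finset.mem_filter.2 ⟨Finset.mem_univ _, h⟩)
    rw [nodalValue, dif_neg this, zero_mul]

end Element

/-- Distinct elements overlap in a null set. -/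
theorem aedisjoint_elements (T : Triangulation Ω) {s t : Finset (Sp d)} (hs : s ∈ T.elements)
    (ht : t ∈ T.elements) (hne : s ≠ t) :
    AEDisjoint volume (convexHull ℝ (s : Set (Sp d))) (convexHull ℝ (t : Set (Sp d))) := by
  classical
  obtain ⟨hsf, hsc⟩ := mem_elements.1 hs
  obtain ⟨htf, htc⟩ := mem_elements.1 ht
  have hsub : convexHull ℝ (s : Set (Sp d)) ∩ convexHull ℝ (t : Set (Sp d))
      ⊆ affineSpan ℝ ((s ∩ t : Finset (Sp d)) : Set (Sp d)) := by
    refine (T.inter_subset_convexHull hsf htf).trans ?_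
    rw [← Finset.coe_inter]
    exact convexHull_subset_affineSpan _
  -- A proper affine subspace is null. If the common vertices spanned the whole space, there would
  -- be d + 1 of them, forcing s = t.
  refine measure_mono_null hsub (Measure.addHaar_affineSubspace volume _ fun htop => ?_)
  have hind : AffineIndependent ℝ ((↑) : (s ∩ t : Finset (Sp d)) → Sp d) :=
    (T.indep hsf).mono (by exact_mod_cast Finset.inter_subset_left)
  have hcard : (s ∩ t).card = d + 1 := by
    have h := hind.affineSpan_eq_top_iff_card_eq_finrank_add_one.1
      (by rw [Subtype.range_coe]; exact htop)
    simpa using h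
  have h1 := Finset.eq_of_subset_of_card_le Finset.inter_subset_left (hsc.trans hcard.symm).le
  have h2 := Finset.eq_of_subset_of_card_le Finset.inter_subset_right (htc.trans hcard.symm).le
  exact hne (h1.symm.trans h2)

/-- Integrals of continuous functions which vanish outside `Ω` are sums over the elements. -/
theorem setIntegral_eq_sum_elements (T : Triangulation Ω) {g : Sp d → ℝ} (hg : Continuous g)
    (hg0 : ∀ x, x ∉ Ω → g x = 0) :
    ∫ x in Ω, g x = ∑ s : T.elements,
      ∫ x in convexHull ℝ ((s : Finset (Sp d)) : Set (Sp d)), g x := by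
  -- Since g vanishes off Ω, passing to the closure costs nothing, whatever the measure of ∂Ω.
  have h1 : ∫ x in Ω, g x = ∫ x in closure Ω, g x := by
    rw [setIntegral_eq_integral_of_forall_compl_eq_zero hg0,
      setIntegral_eq_integral_of_forall_compl_eq_zero
        fun x hx => hg0 x fun h => hx (subset_closure h)]
  rw [h1, T.closure_eq_iUnion_elements, integral_iUnion_ae, tsum_fintype]
  · exact fun s =>
      ((s : Finset (Sp d)).finite_toSet.isClosed_convexHull ℝ).measurableSet.nullMeasurableSet
  · exact fun s t hst => T.aedisjoint_elements s.2 t.2 fun h => hst (Subtype.ext h)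
  · rw [← T.closure_eq_iUnion_elements]
    exact hg.continuousOn.integrableOn_compact T.isCompact_closure

end Triangulation

/-! ### Global load estimate and coercivity of the energy -/

open Triangulation

/-- The interpolant of a product is controlled in `L¹` by the interpolant of one factor, uniformly
with respect to the triangulation. -/
theorem exists_integral_abs_interp_mul_le (d : ℕ) {q : ℕ} (hq : 1 ≤ q) :
    ∃ B : ℝ, 0 ≤ B ∧ ∀ {Ω : Set (Sp d)} (_ : IsOpen Ω) (T : Triangulation Ω)
      (f v : C(closure Ω, ℝ)) (F : ℝ), 0 ≤ F → (∀ x, |f x| ≤ F) →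
      ∫ x in Ω, |T.interp q (f * v) x| ≤ B * F * ∫ x in Ω, |T.interp q v x| := by
  obtain ⟨B, hB, h⟩ := exists_integral_shape_le_uniform d hq
  refine ⟨B, hB, fun {Ω} hΩ T f v F hF0 hF => ?_⟩
  have hsum : ∀ u : C(closure Ω, ℝ), ∫ x in Ω, |T.interp q u x| = ∑ s : T.elements,
      ∫ x in convexHull ℝ ((s : Finset (Sp d)) : Set (Sp d)), |T.interp q u x| := fun u => by
    obtain ⟨hc, h0, -⟩ := T.interp_mem hΩ hq u
    exact T.setIntegral_eq_sum_elements hc.abs fun x hx => by rw [h0 x hx, abs_zero]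
  rw [hsum, hsum, Finset.mul_sum]
  refine Finset.sum_le_sum fun s _ => ?_
  obtain ⟨b, hb⟩ := T.exists_affineBasis s.2
  have he : ∀ u : C(closure Ω, ℝ),
      ∫ x in convexHull ℝ ((s : Finset (Sp d)) : Set (Sp d)), |T.interp q u x|
        = ∫ x in simplex b, |∑ α, nodalValue b q u α * shape q α.1 (b.coords x)| := fun u => by
    rw [← simplex_eq hb]
    refine setIntegral_congr_fun (isCompact_simplex b).measurableSet fun x hx => ?_
    rw [T.interp_eq_sum_shape hq s.2 hb u hx]
  rw [he, he]
  exact h b _ _ F hF0 fun α => abs_nodalValue_mul_le f v hF α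

/-- The energy bounds the `L²` norm of the weak gradient of the interpolant. -/
theorem integral_norm_partialGrad_sq_le {d : ℕ} (hd : 1 ≤ d) {Ω : Set (Sp d)} (hΩ : IsOpen Ω)
    {q : ℕ} (hq : 1 ≤ q) (T : Triangulation Ω) (f v : C(closure Ω, ℝ)) {A R : ℝ} (hR0 : 0 < R)
    (hR : ∀ x ∈ Ω, ‖x‖ ≤ R) (hA : ∫ x in Ω, |T.interp q (f * v) x|
      ≤ A * ∫ x in Ω, |T.interp q v x|) :
    ∫ x in Ω, ‖partialGrad (T.interp q v) x‖ ^ 2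
      ≤ 4 * T.energy q f v + 16 * A ^ 2 * R ^ 2 * volume.real Ω := by
  have hb : Bornology.IsBounded Ω := isBounded_iff_forall_norm_le.2 ⟨R, hR⟩
  have := isFiniteMeasure_restrict_of_isBounded hb
  obtain ⟨L, hL⟩ := T.exists_lipschitzWith_of_mem_femSpace hΩ (T.interp_mem hΩ hq v)
  obtain ⟨hc, h0, -⟩ := T.interp_mem hΩ hq v
  obtain ⟨hc', h0', -⟩ := T.interp_mem hΩ hq (f * v)
  set w := T.interp q v
  have hcont : ∀ {g : Sp d → ℝ}, Continuous g → Integrable g (volume.restrict Ω) := fun hg =>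
    (hg.continuousOn.integrableOn_compact hb.isCompact_closure).mono_set subset_closure
  have hi : Integrable (fun x => ‖partialGrad w x‖ ^ 2) (volume.restrict Ω) :=
    (memLp_partialGrad hL _).integrable_norm_pow (by norm_num)
  have hi' : Integrable (fun x => ‖weakGrad Ω w x‖ ^ 2) (volume.restrict Ω) := by
    refine hi.congr ?_
    filter_upwards [(hasWeakGrad_partialGrad hL).weakGrad_ae_eq hΩ] with x hx
    rw [hx]
  have hE : T.energy q f v = 1 / 2 * (∫ x in Ω, ‖partialGrad w x‖ ^ 2)
      - ∫ x in Ω, T.interp q (f * v) x := by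
    rw [energy, integral_sub (hi'.const_mul _) (hcont hc'), integral_const_mul,
      integral_norm_weakGrad_sq hΩ hL]
  have hsq : Integrable (fun x => w x ^ 2) (volume.restrict Ω) := hcont (hc.pow 2)
  have hP := integral_sq_le_of_lipschitzWith hd hΩ hR hL h0
  have hle : ∫ x in Ω, T.interp q (f * v) x ≤ ∫ x in Ω, |T.interp q (f * v) x| :=
    integral_mono (hcont hc') (hcont hc'.abs) fun x => le_abs_self _
  -- The Young weight 1 / (16 R²) is chosen so that Poincaré's constant 4 R² turns the quadratic
  -- term into a quarter of the gradient integral. Of the ½ in the energy, ¼ then survives, whence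
  -- the factor 4 in the conclusion.
  have hY : A * ∫ x in Ω, |w x|
      ≤ 1 / (16 * R ^ 2) * (∫ x in Ω, w x ^ 2) + 4 * A ^ 2 * R ^ 2 * volume.real Ω := by
    have hconst : 4 * A ^ 2 * R ^ 2 * volume.real Ω = ∫ _ in Ω, 4 * A ^ 2 * R ^ 2 := by
      rw [setIntegral_const, smul_eq_mul, mul_comm]
    rw [hconst, ← integral_const_mul, ← integral_const_mul,
      ← integral_add (hsq.const_mul _) (integrable_const _)]
    refine integral_mono ((hcont hc.abs).const_mul _)
      ((hsq.const_mul _).add (integrable_const _)) fun x => ?_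
    have h1 : 1 / (16 * R ^ 2) * w x ^ 2 + 4 * A ^ 2 * R ^ 2 - A * |w x|
        = (|w x| / (4 * R) - 2 * A * R) ^ 2 := by
      rw [← sq_abs (w x)]
      field_simp
      ring
    have := sq_nonneg (|w x| / (4 * R) - 2 * A * R)
    dsimp only
    linarith
  have hP' : 1 / (16 * R ^ 2) * (∫ x in Ω, w x ^ 2)
      ≤ 1 / 4 * ∫ x in Ω, ‖partialGrad w x‖ ^ 2 := by
    calc _ ≤ 1 / (16 * R ^ 2) * (4 * R ^ 2 * ∫ x in Ω, ‖partialGrad w x‖ ^ 2) := by gcongr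
      _ = _ := by
        field_simp
        ring
  linarith

end DeepRitzFE

end

/-! ### The uniform H¹ bound -/

theorem proposition2p1 {d : ℕ} (hd : 1 ≤ d) (Ω : Set (DeepRitzFE.Sp d)) (hΩ : IsOpen Ω)
    (q : ℕ) (hq : 1 ≤ q) (T : ℕ → DeepRitzFE.Triangulation Ω)
    (σ : ℝ → ℝ) (hσ : Continuous σ) (widths : ℕ → List ℕ)
    (f : C(closure Ω, ℝ)) (C : ℝ) (hC : 0 < C) :
    ∃ C₁ : ℝ, 0 < C₁ ∧
      ∀ v : ℕ → C(closure Ω, ℝ), (∀ ℓ, v ℓ ∈ DeepRitzFE.networkSpace Ω σ (widths ℓ)) →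
        (∀ ℓ, (T ℓ).energy q f (v ℓ) ≤ C) →
        ∀ ℓ, DeepRitzFE.MemH1 Ω ((T ℓ).interp q (v ℓ)) ∧ DeepRitzFE.h1Norm Ω ((T ℓ).interp q (v ℓ)) ≤ C₁ := by
  -- Boundedness of Ω comes from the mesh: its closure is a finite union of simplices.
  have hcpt : IsCompact (closure Ω) := (T 0).isCompact_closure
  have hb : Bornology.IsBounded Ω := hcpt.isBounded.subset subset_closure
  obtain ⟨R, hR0, hR⟩ : ∃ R : ℝ, 0 < R ∧ ∀ x ∈ Ω, ‖x‖ ≤ R := hb.exists_pos_norm_le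
  have : CompactSpace (closure Ω) := isCompact_iff_compactSpace.1 hcpt
  obtain ⟨B, hB0, hB⟩ := DeepRitzFE.exists_integral_abs_interp_mul_le d hq
  -- The second factor bounds the gradient integral, with A = B‖f‖ and energy at most C; the factor
  -- 4 R² + 1 adds the L² part through Poincaré's inequality. Nothing in M depends on ℓ.
  set M := (4 * R ^ 2 + 1) * (4 * C + 16 * (B * ‖f‖) ^ 2 * R ^ 2 * volume.real Ω)
  have hM : 0 < M := by positivity
  refine ⟨√M, Real.sqrt_pos.2 hM, fun v _ hE ℓ => ?_⟩
  obtain ⟨L, hL⟩ := (T ℓ).exists_lipschitzWith_of_mem_femSpace hΩ ((T ℓ).interp_mem hΩ hq (v ℓ))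
  obtain ⟨-, h0, -⟩ := (T ℓ).interp_mem hΩ hq (v ℓ)
  refine ⟨DeepRitzFE.memH1_of_lipschitzWith hb hL h0, Real.sqrt_le_sqrt ?_⟩
  have hgrad := DeepRitzFE.integral_norm_partialGrad_sq_le hd hΩ hq (T ℓ) f (v ℓ) hR0 hR
    (hB hΩ (T ℓ) f (v ℓ) ‖f‖ (norm_nonneg _) fun x => f.norm_coe_le_norm x)
  have hP := DeepRitzFE.integral_sq_le_of_lipschitzWith hd hΩ hR hL h0
  rw [DeepRitzFE.integral_norm_weakGrad_sq hΩ hL]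
  calc _ ≤ (4 * R ^ 2 + 1) * ∫ x in Ω, ‖DeepRitzFE.partialGrad ((T ℓ).interp q (v ℓ)) x‖ ^ 2 := by
        linarith
    _ ≤ M := mul_le_mul_of_nonneg_left (by linarith [hE ℓ]) (by positivity)
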